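/- Let $p$ be a prime, $n$ a positive integer, $\mathrm{Tr}$ the trace from $\mathbb{F}_{p^n}$ to $\mathbb{F}_p$ and $\zeta_p\in\mathbb{C}$ a primitive $p$-th root of unity. The algebraic degree of a function $F:\mathbb{F}_{p^n}\to\mathbb{F}_{p^n}$, written as $F(x)=\sum_{i=0}^{p^n-1}a_ix^i$, is the largest sum of the base-$p$ digits of an exponent $i$ with $a_i\ne 0$; $F$ is quadratic if its algebraic degree is $2$. The Walsh coefficients of $F$ are $\mathcal{W}_F(a,b)=\sum_{x\in\mathbb{F}_{p^n}}\zeta_p^{\mathrm{Tr}(aF(x)+bx)}$ for $a\in\mathbb{F}_{p^n}\setminus\{0\}$, $b\in\mathbb{F}_{p^n}$; together they form the Walsh spectrum of $F$. For $p=2$, $F$ is APN if $2$ is the maximum, over $a\neq 0$ and $b$, of the number of solutions $x$ of $F(x+a)-F(x)=b$. Let $F(x)=G(x^d)$ be a quadratic function from $\mathbb{F}_{p^n}$ to itself, where $G:\mathbb{F}_{p^n}\to\mathbb{F}_{p^n}$, $d$ is a positive integer with $\gcd(d,p^n-1)=p^t+1$ for some integer $t>0$, and $n=2kt$ for some positive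 integer $k$. Assume that the restriction of $G$ to $C_d=\{x^d : x\in\mathbb{F}_{p^n}\}$ (which contains $0$) is injective. Then for all $a,b\in\mathbb{F}_{p^n}$ with $a\ne 0$, $$|\mathcal{W}_F(a,b)|^2\in\{0,\,p^n,\,p^{n+2t}\}.$$ In particular, if $n$ is even and $F(x)=G(x^3)$ is a quadratic APN function on $\mathbb{F}_{2^n}$, where $G:\mathbb{F}_{2^n}\to\mathbb{F}_{2^n}$ is any function, then every Walsh coefficient of $F$ lies in $\{0,\pm 2^{n/2},\pm 2^{n/2+1}\}$, and for $n\ge 4$ the set of values in the Walsh spectrum of $F$ is exactly $\{0,\pm 2^{n/2},\pm 2^{n/2+1}\}$. -/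

import Mathlib

open Polynomial

noncomputable section

/-- The sum of the base-`p` digits of `i`. -/
def pWeight (p i : ℕ) : ℕ := (Nat.digits p i).sum

open Classical in
/-- The unique polynomial of degree less than `|K|` that represents `F : K → K` on the
finite field `K`. -/
def reducedPoly {K : Type*} [Field K] [Fintype K] (F : K → K) : K[X] :=
  Lagrange.interpolate (Finset.univ : Finset K) id F

/-- The algebraic degree of `F : K → K`, for `K` a finite field of characteristic `p`: the largest
`p`-weight of an exponent with a nonzero coefficient in the reduced polynomial of `F`. -/
def algebraicDegree (p : ℕ) {K : Type*} [Field K] [Fintype K] (F : K → K) : ℕ :=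
  (reducedPoly F).support.sup (pWeight p)

/-- `F` is quadratic: its algebraic degree is `2`. -/
def IsQuadratic (p : ℕ) {K : Type*} [Field K] [Fintype K] (F : K → K) : Prop :=
  algebraicDegree p F = 2

/-- `δ_F(a, b)`, the number of solutions `x` of `F (x + a) - F x = b`. -/
def diffCount {K : Type*} [Field K] (F : K → K) (a b : K) : ℕ :=
  Nat.card {x : K // F (x + a) - F x = b}

/-- `F` is differentially `Δ`-uniform: `Δ` is the maximum of `δ_F(a, b)` over `a ≠ 0` and `b`. -/
def IsDifferentiallyUniform {K : Type*} [Field K] (F : K → K) (Δ : ℕ) : Prop :=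
  IsGreatest {m : ℕ | ∃ a b : K, a ≠ 0 ∧ diffCount F a b = m} Δ

/-- `F` is almost perfect nonlinear (a notion for fields of characteristic two). -/
def IsAPN {K : Type*} [Field K] (F : K → K) : Prop :=
  IsDifferentiallyUniform F 2

/-- The Walsh coefficient `∑ x, ζ ^ Tr (a * F x + b * x)`, where `Tr` is the trace to `𝔽_p`
and `ζ` is meant to be a primitive `p`-th root of unity. -/
def walsh (p : ℕ) (ζ : ℂ) {K : Type*} [Field K] [Fintype K] [Algebra (ZMod p) K]
    (F : K → K) (a b : K) : ℂ :=
  ∑ x : K, ζ ^ (Algebra.trace (ZMod p) K (a * F x + b * x)).val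

open Classical in
/-- The Walsh spectrum: the multiset of all Walsh coefficients at `(a, b)` with `a ≠ 0`. -/
def walshSpectrum (p : ℕ) (ζ : ℂ) {K : Type*} [Field K] [Fintype K] [Algebra (ZMod p) K]
    (F : K → K) : Multiset ℂ :=
  (Finset.univ.filter fun ab : K × K => ab.1 ≠ 0).val.map fun ab => walsh p ζ F ab.1 ab.2

end

/-! Put P = p^t and q = p^n = P^(2k), and normalise F(0) = 0. Injectivity of G says that the fibres
of F are the fibres of x^(P+1), so F(wx) = F(x) for a primitive (P+1)-th root of unity w, and the
biadditive polar form B satisfies B(wx, wy) = B(x, y). Hence l and l^P are adjoint for every l in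
the field of P^2 elements generated by w (`polarForm_mul_left`). The radical of ψ(aB) is thus a
space over that field, of size P^(2m(a)), and |W(a, b)|^2 is 0 or q P^(2m(a)). It remains to prove
m(a) ≤ 1 for a ≠ 0.

At b = 0 the Walsh coefficient is known exactly: it is real, it has absolute value P^(k+m(a)), and
it is 1 modulo P + 1 because nonzero fibres have P + 1 elements. So W(a, 0) = (-P)^(k+m(a))
(`exists_charWalsh_zero_eq`). Counting zeros and collisions of F gives the first two moments over a.
They yield ∑ (-P)^m(a) = 0 and ∑ ((-P)^m(a) - 1)((-P)^m(a) + P) = 0 over a ≠ 0. The terms of the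
second sum are nonnegative and vanish only for m(a) ≤ 1; the first sum then forces both 0 and 1 to
occur (`exists_radical_dimension`).

A quadratic APN function G(x^3) is the case p = 2, t = 1, since APN forces injectivity on cubes.
Moments over b then show that every listed value occurs when n ≥ 4. -/

/-! ### Polar forms and algebraic degree -/

/-- The polar form `F (x + y) - F x - F y + F 0` of a map between additive groups. -/
def polarForm {K : Type*} [Field K] (F : K → K) (x y : K) : K :=
  F (x + y) - F x - F y + F 0

/-- The polar form of `F` is additive in its first argument. -/
def HasAdditivePolar {K : Type*} [Field K] (F : K → K) : Prop :=
  ∀ x y z, polarForm F (x + y) z = polarForm F x z + polarForm F y z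

lemma polarForm_comm {K : Type*} [Field K] (F : K → K) (x y : K) :
    polarForm F x y = polarForm F y x := by
  simp only [polarForm, add_comm x y]; ring

lemma HasAdditivePolar.sum {K ι : Type*} [Field K] (s : Finset ι) (c : ι → K) (f : ι → K → K)
    (h : ∀ i ∈ s, HasAdditivePolar (f i)) :
    HasAdditivePolar fun x => ∑ i ∈ s, c i * f i x := by
  have key : ∀ x y, polarForm (fun x => ∑ i ∈ s, c i * f i x) x y =
      ∑ i ∈ s, c i * polarForm (f i) x y := by
    intro x y
    simp only [polarForm, ← Finset.sum_sub_distrib, ← Finset.sum_add_distrib]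
    exact Finset.sum_congr rfl fun i _ => by ring
  intro x y z
  rw [key, key, key, ← Finset.sum_add_distrib]
  exact Finset.sum_congr rfl fun i hi => by rw [h i hi x y z]; ring

/-- The multiset contains each exponent as often as its digit says, so bounding the weight amounts
to bounding a cardinality. -/
lemma exists_multiset_of_digits (p : ℕ) (L : List ℕ) :
    ∃ s : Multiset ℕ, s.card = L.sum ∧ (s.map (p ^ ·)).sum = Nat.ofDigits p L := by
  induction L with
  | nil => exact ⟨0, by simp, by simp⟩
  | cons a L ih =>
    obtain ⟨s, h1, h2⟩ := ih
    refine ⟨Multiset.replicate a 0 + s.map (· + 1), by simp [h1], ?_⟩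
    simp [Nat.ofDigits_cons, ← h2, pow_succ, mul_comm _ p, Multiset.sum_map_mul_left]

/-- A number of `p`-weight at most two is a sum of at most two powers of `p`. -/
lemma eq_sum_pow_of_pWeight_le_two {p e : ℕ} (h : pWeight p e ≤ 2) :
    e = 0 ∨ (∃ i, e = p ^ i) ∨ ∃ i j, e = p ^ i + p ^ j := by
  obtain ⟨s, h1, h2⟩ := exists_multiset_of_digits p (Nat.digits p e)
  rw [Nat.ofDigits_digits] at h2
  have h3 : s.card ≤ 2 := h1.trans_le h
  have h4 : s.card = 0 ∨ s.card = 1 ∨ s.card = 2 := by omega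
  rcases h4 with h4 | h4 | h4
  · rw [Multiset.card_eq_zero] at h4
    subst h4
    left; simpa using h2.symm
  · obtain ⟨i, rfl⟩ := Multiset.card_eq_one.1 h4
    right; left; exact ⟨i, by simpa using h2.symm⟩
  · obtain ⟨i, j, rfl⟩ := Multiset.card_eq_two.1 h4
    right; right; exact ⟨i, j, by simpa using h2.symm⟩

/-- Frobenius powers are additive, so such a monomial is constant, additive, or a product of two
additive maps. -/
lemma hasAdditivePolar_pow {K : Type*} [Field K] (p : ℕ) [Fact p.Prime] [CharP K p] {e : ℕ}
    (h : pWeight p e ≤ 2) : HasAdditivePolar fun x : K => x ^ e := by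
  have hp := (Fact.out : p.Prime).ne_zero
  intro x y z
  rcases eq_sum_pow_of_pWeight_le_two h with rfl | ⟨i, rfl⟩ | ⟨i, j, rfl⟩
  · simp [polarForm]
  · simp [polarForm, add_pow_char_pow, hp]
  · simp only [polarForm, pow_add, add_pow_char_pow, zero_pow (pow_ne_zero _ hp)]
    ring

lemma eval_reducedPoly {K : Type*} [Field K] [Fintype K] (F : K → K) (x : K) :
    (reducedPoly F).eval x = F x := by
  classical
  have := Lagrange.eval_interpolate_at_node (s := Finset.univ) (v := (id : K → K)) F
    (Set.injOn_id _) (Finset.mem_univ x)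
  simp only [reducedPoly]
  convert! this

lemma hasAdditivePolar_of_isQuadratic {K : Type*} [Field K] [Fintype K] (p : ℕ) [Fact p.Prime]
    [CharP K p] {F : K → K} (h : IsQuadratic p F) : HasAdditivePolar F := by
  have hF : (fun x => ∑ e ∈ (reducedPoly F).support, (reducedPoly F).coeff e * x ^ e) = F := by
    funext x
    conv_rhs => rw [← eval_reducedPoly F x, eval_eq_sum, Polynomial.sum]
  rw [← hF]
  refine HasAdditivePolar.sum _ _ _ fun e he => hasAdditivePolar_pow p ?_
  exact (Finset.le_sup (f := pWeight p) he).trans h.le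

/-- Excludes d = 0, for which gcd(0, q - 1) = q - 1 may still have the form p^t + 1. -/
lemma not_isQuadratic_const {K : Type*} [Field K] [Fintype K] (p : ℕ) (c : K) :
    ¬ IsQuadratic p fun _ : K => c := by
  classical
  intro h
  have h1 : reducedPoly (fun _ : K => c) = C c := by
    symm
    have := Lagrange.eq_interpolate_of_eval_eq (s := Finset.univ) (v := (id : K → K)) (f := C c)
      (fun _ : K => c) (Set.injOn_id _)
      (lt_of_le_of_lt degree_C_le (by exact_mod_cast Finset.univ_nonempty.card_pos)) (by simp)
    simp only [reducedPoly]
    convert this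
  have h2 : algebraicDegree p (fun _ : K => c) = 0 := by
    rw [algebraicDegree, h1, ← Nat.le_zero]
    refine Finset.sup_le fun e he => ?_
    have : e = 0 := by
      by_contra h0
      simp [coeff_C, h0] at he
    simp [this, pWeight]
  rw [IsQuadratic, h2] at h
  omega

/-! ### Invariance of the polar form under roots of unity -/

/-- `F` vanishes at `0`, has biadditive polar form, and its fibres are the cosets of the group
of `D`-th roots of unity. -/
structure IsDivisibleQuadratic {K : Type*} [Field K] (D : ℕ) (F : K → K) : Prop where
  map_zero : F 0 = 0
  polar_add : HasAdditivePolar F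
  eq_iff : ∀ x y, F x = F y ↔ x ^ D = y ^ D

namespace IsDivisibleQuadratic

variable {K : Type*} [Field K] {D : ℕ} {F : K → K}

lemma add_eq (h : IsDivisibleQuadratic D F) (x y : K) :
    F (x + y) = F x + F y + polarForm F x y := by
  rw [polarForm, h.map_zero]; ring

lemma polarForm_zero_left (h : IsDivisibleQuadratic D F) (y : K) : polarForm F 0 y = 0 := by
  simp [polarForm, h.map_zero]

lemma polarForm_zero_right (h : IsDivisibleQuadratic D F) (y : K) : polarForm F y 0 = 0 := by
  simp [polarForm, h.map_zero]

lemma polarForm_add_right (h : IsDivisibleQuadratic D F) (x y z : K) :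
    polarForm F x (y + z) = polarForm F x y + polarForm F x z := by
  rw [polarForm_comm, h.polar_add, polarForm_comm F y, polarForm_comm F z]

lemma polarForm_neg_left (h : IsDivisibleQuadratic D F) (x y : K) :
    polarForm F (-x) y = - polarForm F x y := by
  have := h.polar_add (-x) x y
  rw [neg_add_cancel, h.polarForm_zero_left] at this
  linear_combination -this

lemma polarForm_neg_right (h : IsDivisibleQuadratic D F) (x y : K) :
    polarForm F x (-y) = - polarForm F x y := by
  rw [polarForm_comm, h.polarForm_neg_left, polarForm_comm]

lemma map_root_mul (h : IsDivisibleQuadratic D F) {w : K} (hw : w ^ D = 1) (x : K) :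
    F (w * x) = F x := by
  rw [h.eq_iff, mul_pow, hw, one_mul]

lemma polarForm_root_mul (h : IsDivisibleQuadratic D F) {w : K} (hw : w ^ D = 1) (x y : K) :
    polarForm F (w * x) (w * y) = polarForm F x y := by
  simp only [polarForm, ← mul_add, h.map_root_mul hw]

/-- The elements of the subfield generated by a `(p ^ t + 1)`-th root of unity have their
`p ^ t`-th powers as adjoints with respect to the polar form. -/
lemma polarForm_mul_left {p t : ℕ} [Fact p.Prime] [CharP K p]
    (h : IsDivisibleQuadratic (p ^ t + 1) F) {w : K} (hw : w ^ (p ^ t + 1) = 1)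
    {l : K} (hl : l ∈ Subfield.closure {w}) (x y : K) :
    polarForm F (l * x) y = polarForm F x (l ^ p ^ t * y) := by
  -- Since l ↦ l^(p^t) is a ring homomorphism, the l with this adjoint property form a subfield; w
  -- belongs to it because w^(p^t) = w⁻¹ and B is invariant under w.
  induction hl using Subfield.closure_induction generalizing x y with
  | mem l hl =>
    rw [Set.mem_singleton_iff.1 hl]
    nth_rw 1 [show y = w * (w ^ p ^ t * y) by rw [← mul_assoc, ← pow_succ', hw, one_mul]]
    exact h.polarForm_root_mul hw _ _
  | one => simp
  | add a b _ _ iha ihb =>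
    rw [add_mul, h.polar_add, iha, ihb, add_pow_char_pow, add_mul, h.polarForm_add_right]
  | neg a _ ih =>
    have : (-a) ^ p ^ t = - a ^ p ^ t := by
      have := add_pow_char_pow (R := K) (p := p) (n := t) (-a) a
      rw [neg_add_cancel, zero_pow (pow_ne_zero _ (Fact.out : p.Prime).ne_zero)] at this
      linear_combination -this
    rw [this, neg_mul, neg_mul, h.polarForm_neg_left, h.polarForm_neg_right, ih]
  | inv a _ ih =>
    rcases eq_or_ne a 0 with rfl | ha
    · rw [inv_zero, zero_mul, zero_pow (pow_ne_zero _ (Fact.out : p.Prime).ne_zero), zero_mul,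
        h.polarForm_zero_left, h.polarForm_zero_right]
    · have := ih (a⁻¹ * x) ((a⁻¹) ^ p ^ t * y)
      rw [mul_inv_cancel_left₀ ha, ← mul_assoc (a ^ p ^ t), ← mul_pow, mul_inv_cancel₀ ha,
        one_pow, one_mul] at this
      exact this.symm
  | mul a b _ _ iha ihb =>
    rw [mul_assoc, iha, ihb, mul_pow]
    congr 1; ring

end IsDivisibleQuadratic

/-! ### The field generated by the root of unity -/

/-- Modulo p^t + 1 one has p^t = -1, so p^i = 1 gives p^(i-t) = -1; then p^(i-t) + 1 is a positive
multiple of p^t + 1. -/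
lemma dvd_pow_sub_one_imp_le {p t i : ℕ} (hp : 1 < p) (hi : 0 < i)
    (h : p ^ t + 1 ∣ p ^ i - 1) : 2 * t ≤ i := by
  have hpi : p ≤ p ^ i := Nat.le_self_pow hi.ne' p
  have h1 : p ^ t < p ^ i := by
    have := Nat.le_of_dvd (by omega) h
    omega
  have h2 : t < i := (Nat.pow_lt_pow_iff_right hp).1 h1
  obtain ⟨j, rfl⟩ := Nat.exists_eq_add_of_lt h2
  have h3 : p ^ t + 1 ∣ p ^ (j + 1) + 1 := by
    have e : p ^ (t + j + 1) = p ^ (j + 1) * p ^ t := by rw [← pow_add]; ring_nf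
    have e2 : p ^ (j + 1) + 1 = p ^ (j + 1) * (p ^ t + 1) - (p ^ (t + j + 1) - 1) := by
      rw [e] at hpi ⊢
      rw [mul_add]
      omega
    rw [e2]
    exact Nat.dvd_sub (Dvd.intro_left _ rfl) h
  have h4 := Nat.le_of_dvd (by omega) h3
  have h5 : p ^ t ≤ p ^ (j + 1) := by omega
  have := (Nat.pow_le_pow_iff_right hp).1 h5
  omega

/-- A `(p ^ t + 1)`-th primitive root of unity generates the field with `p ^ (2 * t)` elements. -/
lemma card_closure_primitiveRoot {K : Type*} [Field K] [Finite K] {p t : ℕ} [Fact p.Prime]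
    [CharP K p] (ht : 0 < t) {w : K} (hw : IsPrimitiveRoot w (p ^ t + 1)) :
    Nat.card (Subfield.closure {w}) = p ^ (2 * t) := by
  classical
  have hp := (Fact.out : p.Prime)
  have := Fintype.ofFinite (Subfield.closure {w})
  apply le_antisymm
  · have h1 : Subfield.closure {w} ≤
        (iterateFrobenius K p (2 * t)).eqLocusField (RingHom.id K) := by
      rw [Subfield.closure_le, Set.singleton_subset_iff]
      change iterateFrobenius K p (2 * t) w = w
      rw [iterateFrobenius_def]
      have e : p ^ (2 * t) = (p ^ t + 1) * (p ^ t - 1) + 1 := by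
        have : 1 ≤ p ^ t := Nat.one_le_pow _ _ hp.pos
        obtain ⟨m, hm⟩ := Nat.exists_eq_add_of_le this
        rw [mul_comm, pow_mul, hm, Nat.add_sub_cancel_left]; ring
      rw [e, pow_succ, pow_mul, hw.pow_eq_one, one_pow, one_mul]
    have hne : (X ^ p ^ (2 * t) - X : K[X]) ≠ 0 :=
      FiniteField.X_pow_card_pow_sub_X_ne_zero K (by omega) hp.one_lt
    have h2 : (Subfield.closure {w} : Set K) ⊆ (X ^ p ^ (2 * t) - X : K[X]).roots.toFinset := by
      intro x hx
      have : x ^ p ^ (2 * t) = x := by simpa [iterateFrobenius_def] using h1 hx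
      simp [hne, this]
    have h3 := Set.ncard_le_ncard h2
    rw [Set.ncard_coe_finset] at h3
    calc Nat.card (Subfield.closure {w}) ≤ _ := h3
      _ ≤ _ := Multiset.toFinset_card_le _
      _ ≤ _ := card_roots' _
      _ = _ := FiniteField.X_pow_card_pow_sub_X_natDegree_eq K (by omega) hp.one_lt
  · obtain ⟨i, -, hi⟩ := FiniteField.card (Subfield.closure {w}) p
    rw [Nat.card_eq_fintype_card, hi]
    refine Nat.pow_le_pow_right hp.pos (dvd_pow_sub_one_imp_le hp.one_lt i.pos ?_)
    rw [← hi]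
    apply hw.dvd_of_pow_eq_one
    have h0 : (⟨w, Subfield.subset_closure rfl⟩ : Subfield.closure {w}) ≠ 0 := by
      intro h
      exact hw.ne_zero (by omega) (congrArg Subtype.val h)
    simpa using congrArg Subtype.val (FiniteField.pow_card_sub_one_eq_one _ h0)

/-! ### Walsh sums and their moments -/

/-- The Walsh coefficient of `F` with respect to an additive character `ψ`. -/
noncomputable def charWalsh {K : Type*} [Field K] [Fintype K] (ψ : AddChar K ℂ) (F : K → K)
    (a b : K) : ℂ :=
  ∑ x, ψ (a * F x + b * x)

section Moments

variable {K : Type*} [Field K] [Fintype K] {ψ : AddChar K ℂ}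

lemma charWalsh_normSq (F : K → K) (a b : K) :
    charWalsh ψ F a b * starRingEnd ℂ (charWalsh ψ F a b) =
      ∑ x, ∑ y, ψ (a * (F x - F y) + b * (x - y)) := by
  simp only [charWalsh, map_sum, ← AddChar.map_neg_eq_conj, Finset.sum_mul_sum,
    ← AddChar.map_add_eq_mul]
  exact Finset.sum_congr rfl fun x _ => Finset.sum_congr rfl fun y _ => by congr 1; ring

open Classical in
lemma sum_mul_eq_ite (hψ : ψ.IsPrimitive) (c : K) :
    ∑ a, ψ (a * c) = if c = 0 then (Fintype.card K : ℂ) else 0 := by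
  rw [AddChar.sum_mulShift c hψ]; split_ifs <;> simp

open Classical in
lemma sum_charWalsh_zero (hψ : ψ.IsPrimitive) (F : K → K) :
    ∑ a, charWalsh ψ F a 0 = Fintype.card K * ((Finset.univ.filter fun x => F x = 0).card : ℂ) := by
  simp only [charWalsh, zero_mul, add_zero]
  rw [Finset.sum_comm]
  simp only [sum_mul_eq_ite hψ, ← Finset.sum_filter, Finset.sum_const, nsmul_eq_mul, mul_comm]

open Classical in
lemma sum_charWalsh_normSq_zero (hψ : ψ.IsPrimitive) (F : K → K) :
    ∑ a, charWalsh ψ F a 0 * starRingEnd ℂ (charWalsh ψ F a 0) =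
      Fintype.card K * ∑ x, ((Finset.univ.filter fun y => F x = F y).card : ℂ) := by
  simp only [charWalsh_normSq, zero_mul, add_zero]
  rw [Finset.sum_comm, Finset.mul_sum]
  refine Finset.sum_congr rfl fun x _ => ?_
  rw [Finset.sum_comm]
  simp only [sum_mul_eq_ite hψ, sub_eq_zero, ← Finset.sum_filter, Finset.sum_const, nsmul_eq_mul,
    mul_comm]

lemma sum_charWalsh_right (hψ : ψ.IsPrimitive) (F : K → K) (a : K) :
    ∑ b, charWalsh ψ F a b = Fintype.card K * ψ (a * F 0) := by
  classical
  simp only [charWalsh]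
  rw [Finset.sum_comm]
  simp only [AddChar.map_add_eq_mul, ← Finset.mul_sum, sum_mul_eq_ite hψ]
  simp [mul_comm]

lemma sum_charWalsh_normSq_right (hψ : ψ.IsPrimitive) (F : K → K) (a : K) :
    ∑ b, charWalsh ψ F a b * starRingEnd ℂ (charWalsh ψ F a b) = (Fintype.card K : ℂ) ^ 2 := by
  classical
  simp only [charWalsh_normSq]
  rw [Finset.sum_comm]
  have : ∀ x, ∑ b, ∑ y, ψ (a * (F x - F y) + b * (x - y)) = Fintype.card K := by
    intro x
    rw [Finset.sum_comm]
    simp only [AddChar.map_add_eq_mul, ← Finset.mul_sum, sum_mul_eq_ite hψ, sub_eq_zero]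
    simp
  simp [this, sq]

end Moments

/-! ### The radical and the absolute values -/

namespace IsDivisibleQuadratic

variable {K : Type*} [Field K] {D : ℕ} {F : K → K}

/-- The character `y ↦ ψ (a * B(u, y))` attached to the polar form `B` of `F`. -/
def polarChar (h : IsDivisibleQuadratic D F) (ψ : AddChar K ℂ) (a u : K) : AddChar K ℂ where
  toFun y := ψ (a * polarForm F u y)
  map_zero_eq_one' := by simp [h.polarForm_zero_right]
  map_add_eq_mul' x y := by rw [h.polarForm_add_right, mul_add, AddChar.map_add_eq_mul]

/-- The radical of the bicharacter `ψ (a * B(x, y))`, where `B` is the polar form of `F`. -/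
def radical (h : IsDivisibleQuadratic D F) (ψ : AddChar K ℂ) (a : K) : AddSubgroup K where
  carrier := {u | ∀ y, ψ (a * polarForm F u y) = 1}
  zero_mem' y := by simp [h.polarForm_zero_left]
  add_mem' {u v} hu hv y := by
    rw [h.polar_add, mul_add, AddChar.map_add_eq_mul, hu, hv, one_mul]
  neg_mem' {u} hu y := by
    rw [h.polarForm_neg_left, mul_neg, AddChar.map_neg_eq_inv, hu, inv_one]

lemma mem_radical (h : IsDivisibleQuadratic D F) {ψ : AddChar K ℂ} {a u : K} :
    u ∈ h.radical ψ a ↔ ∀ y, ψ (a * polarForm F u y) = 1 := Iff.rfl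

lemma polarChar_eq_zero_iff (h : IsDivisibleQuadratic D F) {ψ : AddChar K ℂ} {a u : K} :
    h.polarChar ψ a u = 0 ↔ u ∈ h.radical ψ a := by
  rw [mem_radical, DFunLike.ext_iff]; rfl

/-- On the radical, `ψ (a * F u + b * u)` is a character. -/
def radicalChar (h : IsDivisibleQuadratic D F) (ψ : AddChar K ℂ) (a b : K) :
    AddChar (h.radical ψ a) ℂ where
  toFun u := ψ (a * F u + b * u)
  map_zero_eq_one' := by simp [h.map_zero]
  map_add_eq_mul' u v := by
    rw [← AddChar.map_add_eq_mul]
    have := u.2 (v : K)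
    rw [AddSubgroup.coe_add, h.add_eq, show a * (F u + F v + polarForm F u v) + b * ((u : K) + v) =
      a * F u + b * u + (a * F v + b * v) + a * polarForm F u v by ring,
      AddChar.map_add_eq_mul, this, mul_one]

variable [Fintype K] {ψ : AddChar K ℂ}

-- With x = u + y the exponent depends on y only through B(u, y), and summing over y kills every u
-- outside the radical.
open Classical in
lemma charWalsh_normSq_eq (h : IsDivisibleQuadratic D F) (a b : K) :
    charWalsh ψ F a b * starRingEnd ℂ (charWalsh ψ F a b) =
      Fintype.card K * ∑ u, h.radicalChar ψ a b u := by
  rw [charWalsh_normSq, Finset.sum_comm]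
  have h1 : ∀ y, ∑ x, ψ (a * (F x - F y) + b * (x - y)) =
      ∑ u, ψ (a * F u + b * u) * h.polarChar ψ a u y := by
    intro y
    rw [← Equiv.sum_comp (Equiv.addRight y)]
    refine Finset.sum_congr rfl fun u _ => ?_
    change _ = _ * ψ (a * polarForm F u y)
    rw [← AddChar.map_add_eq_mul]
    simp only [Equiv.coe_addRight, h.add_eq]
    congr 1; ring
  simp only [h1]
  rw [Finset.sum_comm]
  have h2 : ∀ u, ∑ y, h.polarChar ψ a u y =
      if u ∈ h.radical ψ a then (Fintype.card K : ℂ) else 0 := by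
    intro u
    rw [AddChar.sum_eq_ite]
    simp only [h.polarChar_eq_zero_iff]
  simp only [← Finset.mul_sum, h2]
  simp only [mul_ite, mul_zero, ← Finset.sum_filter, ← Finset.sum_mul]
  rw [mul_comm]
  congr 1
  exact Finset.sum_subtype _ (by simp) _

lemma charWalsh_norm_sq_cases (h : IsDivisibleQuadratic D F) (a b : K) :
    ‖charWalsh ψ F a b‖ ^ 2 = 0 ∨
      ‖charWalsh ψ F a b‖ ^ 2 = Fintype.card K * Nat.card (h.radical ψ a) := by
  classical
  have h1 := h.charWalsh_normSq_eq (ψ := ψ) a b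
  rw [Complex.mul_conj', AddChar.sum_eq_ite] at h1
  split_ifs at h1 with h2
  · right
    rw [Nat.card_eq_fintype_card]
    exact_mod_cast h1
  · left
    rw [mul_zero] at h1
    exact_mod_cast h1

variable {p t : ℕ} [Fact p.Prime] [CharP K p]

/-- The radical as a vector space over the field generated by a root of unity. -/
def radicalSubmodule (h : IsDivisibleQuadratic (p ^ t + 1) F) {w : K}
    (hw : w ^ (p ^ t + 1) = 1) (ψ : AddChar K ℂ) (a : K) :
    Submodule (Subfield.closure {w}) K where
  __ := h.radical ψ a
  smul_mem' l u hu y := by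
    change ψ (a * polarForm F (l * u) y) = 1
    rw [h.polarForm_mul_left hw l.2]
    exact hu _

lemma exists_card_radical (h : IsDivisibleQuadratic (p ^ t + 1) F) (ht : 0 < t) {w : K}
    (hw : IsPrimitiveRoot w (p ^ t + 1)) (ψ : AddChar K ℂ) (a : K) :
    ∃ m, Nat.card (h.radical ψ a) = (p ^ (2 * t)) ^ m := by
  refine ⟨Module.finrank (Subfield.closure {w}) (h.radicalSubmodule hw.pow_eq_one ψ a), ?_⟩
  rw [← card_closure_primitiveRoot ht hw]
  exact Module.natCard_eq_pow_finrank (K := Subfield.closure {w})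
    (V := h.radicalSubmodule hw.pow_eq_one ψ a)

/-- At b = 0 the character on the radical is invariant under w. Every u in the radical is wv - v
with v = u/(w - 1) in the radical, so the character is trivial. -/
lemma charWalsh_norm_sq_zero (h : IsDivisibleQuadratic (p ^ t + 1) F) {w : K}
    (hw : IsPrimitiveRoot w (p ^ t + 1)) (a : K) :
    ‖charWalsh ψ F a 0‖ ^ 2 = Fintype.card K * Nat.card (h.radical ψ a) := by
  classical
  have h1 := h.charWalsh_normSq_eq (ψ := ψ) a 0
  have hp := (Fact.out : p.Prime)
  have hne : w - 1 ≠ 0 := by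
    intro h0
    have : p ^ t + 1 = 1 := hw.unique (by rw [sub_eq_zero.1 h0]; exact IsPrimitiveRoot.one)
    exact pow_ne_zero t hp.ne_zero (by omega)
  have h2 : h.radicalChar ψ a 0 = 0 := by
    ext u
    have hwm : w ∈ Subfield.closure {w} := Subfield.subset_closure rfl
    have hc : (w - 1)⁻¹ ∈ Subfield.closure {w} := inv_mem (sub_mem hwm (one_mem _))
    have mem : ∀ l ∈ Subfield.closure {w}, ∀ v ∈ h.radical ψ a, l * v ∈ h.radical ψ a :=
      fun l hl v hv => (h.radicalSubmodule hw.pow_eq_one ψ a).smul_mem ⟨l, hl⟩ hv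
    let v : h.radical ψ a := ⟨(w - 1)⁻¹ * u, mem _ hc _ u.2⟩
    let v' : h.radical ψ a := ⟨w * v, mem _ hwm _ v.2⟩
    have e : u = v' - v := by
      apply Subtype.ext
      change (u : K) = w * ((w - 1)⁻¹ * u) - (w - 1)⁻¹ * u
      field_simp
    have e2 : h.radicalChar ψ a 0 v' = h.radicalChar ψ a 0 v := by
      change ψ (a * F (w * v) + 0 * (w * v)) = ψ (a * F v + 0 * v)
      rw [h.map_root_mul hw.pow_eq_one, zero_mul, zero_mul]
    rw [e, AddChar.map_sub_eq_div, e2]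
    refine div_self ?_
    exact norm_ne_zero_iff.1 (by rw [AddChar.norm_apply]; exact one_ne_zero)
  rw [Complex.mul_conj', AddChar.sum_eq_ite, if_pos h2] at h1
  rw [Nat.card_eq_fintype_card]
  exact_mod_cast h1

end IsDivisibleQuadratic

/-! ### The exact value at b = 0 -/

namespace IsDivisibleQuadratic

open Classical in
lemma card_fiber {K : Type*} [Field K] [Fintype K] {F : K → K} {D : ℕ}
    (h : IsDivisibleQuadratic D F) (hD : 0 < D) {w : K}
    (hw : IsPrimitiveRoot w D) {x : K} (hx : x ≠ 0) :
    (Finset.univ.filter fun y => F x = F y).card = D := by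
  have e : (Finset.univ.filter fun y => F x = F y) = (nthRoots D (x ^ D)).toFinset := by
    ext y
    simp [mem_nthRoots hD, h.eq_iff, eq_comm]
  rw [e, Multiset.toFinset_card_of_nodup (hw.nthRoots_nodup (pow_ne_zero _ hx)),
    hw.card_nthRoots, if_pos ⟨x, rfl⟩]

variable {K : Type*} [Field K] [Fintype K] {F : K → K} {ψ : AddChar K ℂ}
  {p t : ℕ} [Fact p.Prime] [CharP K p]

-- For odd p, F is even, so 2F(x) = B(x, x), and adjointness gives F(lx) = -F(x) once l^(p^t+1) =
-- -1.
open Classical in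
lemma exists_map_mul_eq_neg (h : IsDivisibleQuadratic (p ^ t + 1) F) (ht : 0 < t) {w : K}
    (hw : IsPrimitiveRoot w (p ^ t + 1)) : ∃ l : K, l ≠ 0 ∧ ∀ x, F (l * x) = - F x := by
  have hp := (Fact.out : p.Prime)
  rcases hp.eq_two_or_odd' with rfl | hodd
  · exact ⟨1, one_ne_zero, fun x => by rw [one_mul, CharTwo.neg_eq]⟩
  have h2 : (2 : K) ≠ 0 := by
    intro h0
    have : p ∣ 2 := (CharP.cast_eq_zero_iff K p 2).1 (by exact_mod_cast h0)
    have := (Nat.prime_dvd_prime_iff_eq hp Nat.prime_two).1 this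
    subst this
    exact absurd hodd (by decide)
  have hodd' : Odd (p ^ t) := hodd.pow
  obtain ⟨r, hr⟩ := hodd'
  -- an element of norm `-1`
  let A := Subfield.closure {w}
  have := Fintype.ofFinite A
  obtain ⟨g, hg⟩ := IsCyclic.exists_generator (α := Aˣ)
  have hcard : Fintype.card A = p ^ (2 * t) := by
    rw [← Nat.card_eq_fintype_card]; exact card_closure_primitiveRoot ht hw
  have hord : orderOf g = 2 * r * (p ^ t + 1) := by
    rw [orderOf_eq_card_of_forall_mem_zpowers hg, Nat.card_eq_fintype_card, Fintype.card_units,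
      hcard, mul_comm 2 t, pow_mul, hr, ← Nat.add_sub_cancel (n := 2 * r * (2 * r + 1 + 1)) (m := 1)]
    congr 1; ring
  have hr0 : 0 < r := by
    have : 1 < p ^ t := Nat.one_lt_pow ht.ne' hp.one_lt
    omega
  -- With p^t = 2r + 1, g has order 2r(p^t + 1), so l^(p^t+1) is g raised to half its order, namely
  -- -1.
  let l : Aˣ := g ^ r
  have hl1 : l ^ (p ^ t + 1) ≠ 1 := by
    intro hl
    have : orderOf g ∣ r * (p ^ t + 1) := orderOf_dvd_of_pow_eq_one (by rw [pow_mul]; exact hl)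
    have := Nat.le_of_dvd (by positivity) this
    rw [hord] at this
    have h3 : 0 < r * (p ^ t + 1) := by positivity
    nlinarith
  have hl2 : (l ^ (p ^ t + 1)) ^ 2 = 1 := by
    rw [← pow_mul, ← pow_mul, show r * ((p ^ t + 1) * 2) = orderOf g by rw [hord]; ring,
      pow_orderOf_eq_one]
  have hl3 : ((l : A) : K) ^ (p ^ t + 1) = -1 := by
    have e1 : (((l : A) : K) ^ (p ^ t + 1)) ^ 2 = 1 := by
      simpa using congrArg (fun u : Aˣ => ((u : A) : K)) hl2
    rcases mul_self_eq_one_iff.1 ((sq _).symm.trans e1) with e | e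
    · exfalso
      apply hl1
      apply Units.ext
      apply Subtype.ext
      simpa using e
    · exact e
  refine ⟨(l : A), by simp, fun x => ?_⟩
  have hneg : ∀ x, F (-x) = F x := fun x => by
    have : (-1 : K) ^ (p ^ t + 1) = 1 := by
      rw [hr]; exact Even.neg_one_pow ⟨r + 1, by ring⟩
    simpa using h.map_root_mul this x
  have hpol : ∀ x, polarForm F x x = 2 * F x := by
    intro x
    have := h.add_eq x (-x)
    rw [add_neg_cancel, h.map_zero, hneg, h.polarForm_neg_right] at this
    linear_combination this
  apply mul_left_cancel₀ h2
  rw [← hpol, h.polarForm_mul_left hw.pow_eq_one (l : A).2, ← mul_assoc, ← pow_succ, hl3,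
    neg_one_mul, h.polarForm_neg_right, hpol]
  ring

lemma conj_charWalsh_zero (h : IsDivisibleQuadratic (p ^ t + 1) F) (ht : 0 < t) {w : K}
    (hw : IsPrimitiveRoot w (p ^ t + 1)) (a : K) :
    starRingEnd ℂ (charWalsh ψ F a 0) = charWalsh ψ F a 0 := by
  obtain ⟨l, hl0, hl⟩ := h.exists_map_mul_eq_neg ht hw
  simp only [charWalsh, map_sum, ← AddChar.map_neg_eq_conj, zero_mul, add_zero, ← mul_neg, ← hl]
  exact Equiv.sum_comp (Equiv.mulLeft₀ l hl0) fun x => ψ (a * F x)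

end IsDivisibleQuadratic

lemma int_dvd_of_isIntegral {N : ℤ} {D : ℕ} (hD : D ≠ 0) {z : ℂ} (hz : IsIntegral ℤ z)
    (h : (N : ℂ) = D * z) : (D : ℤ) ∣ N := by
  have hD' : (D : ℂ) ≠ 0 := by exact_mod_cast hD
  have e : z = algebraMap ℚ ℂ (N / D) := by
    rw [map_div₀]
    simp only [map_intCast, map_natCast]
    rw [h, mul_div_cancel_left₀ _ hD']
  rw [e, isIntegral_algebraMap_iff (algebraMap ℚ ℂ).injective,
    IsIntegrallyClosed.isIntegral_iff] at hz
  obtain ⟨y, hy⟩ := hz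
  refine ⟨y, ?_⟩
  have hD'' : (D : ℚ) ≠ 0 := by exact_mod_cast hD
  rw [eq_div_iff hD''] at hy
  have : (y * D : ℚ) = N := by simpa using hy
  rw [mul_comm]
  exact_mod_cast this.symm

/-- The congruence fixes the sign: (-P)^j is 1 modulo P + 1, and the opposite sign would make P + 1
divide 2. -/
lemma eq_neg_pow_of_dvd_sub_one {P s : ℤ} {j : ℕ} (hP : 2 ≤ P) (h : P + 1 ∣ s - 1)
    (hs : s ^ 2 = (P ^ j) ^ 2) : s = (-P) ^ j := by
  have h1 : P + 1 ∣ (-P) ^ j - 1 := by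
    have := sub_dvd_pow_sub_pow (-P) 1 j
    rw [one_pow] at this
    exact (dvd_neg.2 (dvd_refl _)).trans (by rwa [neg_add'])
  have h2 : s ^ 2 = ((-P) ^ j) ^ 2 := by rw [hs, ← pow_mul, ← pow_mul, mul_comm, pow_mul, pow_mul,
    neg_sq]
  rcases sq_eq_sq_iff_eq_or_eq_neg.1 h2 with h3 | h3
  · exact h3
  · exfalso
    have h4 := dvd_add h h1
    rw [h3, show -(-P) ^ j - 1 + ((-P) ^ j - 1) = -2 by ring, dvd_neg] at h4
    have := Int.le_of_dvd (by norm_num) h4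
    omega

lemma isIntegral_addChar {K : Type*} [Field K] (p : ℕ) [Fact p.Prime] [CharP K p]
    (ψ : AddChar K ℂ) (x : K) : IsIntegral ℤ (ψ x) := by
  have hp := (Fact.out : p.Prime).pos
  refine IsIntegral.of_pow hp ?_
  rw [← AddChar.map_nsmul_eq_pow, nsmul_eq_mul, CharP.cast_eq_zero, zero_mul,
    AddChar.map_zero_eq_one]
  exact isIntegral_one

namespace IsDivisibleQuadratic

open Classical in
lemma filter_eq_zero {K : Type*} [Field K] [Fintype K] {F : K → K} {D : ℕ}
    (h : IsDivisibleQuadratic D F) (hD : D ≠ 0) :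
    (Finset.univ.filter fun x => F x = 0) = {0} := by
  ext x
  have := h.eq_iff x 0
  rw [h.map_zero, zero_pow hD, pow_eq_zero_iff hD] at this
  simp [this]

variable {K : Type*} [Field K] [Fintype K] {F : K → K} {ψ : AddChar K ℂ}
  {p t : ℕ} [Fact p.Prime] [CharP K p]

/-- The 1 comes from x = 0; the other x group into fibres of size p^t + 1, leaving a sum of roots of
unity. -/
lemma charWalsh_zero_eq_one_add (h : IsDivisibleQuadratic (p ^ t + 1) F) {w : K}
    (hw : IsPrimitiveRoot w (p ^ t + 1)) (a : K) :
    ∃ z, IsIntegral ℤ z ∧ charWalsh ψ F a 0 = 1 + (p ^ t + 1 : ℕ) * z := by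
  classical
  refine ⟨∑ v ∈ (Finset.univ.erase (0 : K)).image F, ψ (a * v),
    IsIntegral.sum _ fun v _ => isIntegral_addChar p ψ _, ?_⟩
  simp only [charWalsh, zero_mul, add_zero]
  rw [← Finset.add_sum_erase _ _ (Finset.mem_univ (0 : K)), h.map_zero, mul_zero,
    AddChar.map_zero_eq_one, Finset.sum_comp (fun v => ψ (a * v)) F, Finset.mul_sum]
  congr 1
  refine Finset.sum_congr rfl fun v hv => ?_
  obtain ⟨x, hx, rfl⟩ := Finset.mem_image.1 hv
  have hx0 := Finset.ne_of_mem_erase hx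
  rw [nsmul_eq_mul, ← h.card_fiber (Nat.succ_pos _) hw hx0]
  congr 3
  ext y
  simp only [Finset.mem_filter, Finset.mem_erase, Finset.mem_univ, true_and, and_true]
  constructor
  · rintro ⟨_, h1⟩; exact h1.symm
  · intro h1
    refine ⟨?_, h1.symm⟩
    rintro rfl
    rw [h.eq_iff, zero_pow (Nat.succ_ne_zero _), pow_eq_zero_iff (Nat.succ_ne_zero _)] at h1
    exact hx0 h1

lemma exists_charWalsh_zero_eq (h : IsDivisibleQuadratic (p ^ t + 1) F) (ht : 0 < t) {w : K}
    (hw : IsPrimitiveRoot w (p ^ t + 1)) {k : ℕ} (hK : Fintype.card K = (p ^ t) ^ (2 * k))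
    (a : K) : ∃ m : ℕ, Nat.card (h.radical ψ a) = (p ^ (2 * t)) ^ m ∧
      charWalsh ψ F a 0 = ((-(p ^ t : ℤ)) ^ (k + m) : ℤ) := by
  obtain ⟨m, hm⟩ := h.exists_card_radical ht hw ψ a
  refine ⟨m, hm, ?_⟩
  have hP : 1 < p ^ t := Nat.one_lt_pow ht.ne' (Fact.out : p.Prime).one_lt
  obtain ⟨r, hr⟩ := Complex.conj_eq_iff_real.1 (h.conj_charWalsh_zero (ψ := ψ) ht hw a)
  have hsq := h.charWalsh_norm_sq_zero (ψ := ψ) hw a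
  rw [hr, Complex.norm_real, Real.norm_eq_abs, sq_abs, hK, hm] at hsq
  have hsq' : r ^ 2 = ((p ^ t : ℝ) ^ (k + m)) ^ 2 := by
    rw [hsq]; push_cast; ring
  obtain ⟨s, hs, hs2⟩ : ∃ s : ℤ, r = s ∧ s ^ 2 = ((p ^ t : ℤ) ^ (k + m)) ^ 2 := by
    rcases sq_eq_sq_iff_eq_or_eq_neg.1 hsq' with e | e
    · exact ⟨(p ^ t : ℤ) ^ (k + m), by rw [e]; push_cast; rfl, rfl⟩
    · exact ⟨-(p ^ t : ℤ) ^ (k + m), by rw [e]; push_cast; rfl, by rw [neg_sq]⟩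
  obtain ⟨z, hz, hz2⟩ := h.charWalsh_zero_eq_one_add (ψ := ψ) hw a
  have hrs : charWalsh ψ F a 0 = (s : ℂ) := by rw [hr, hs]; push_cast; rfl
  rw [hrs] at hz2 ⊢
  have hdvd : ((p ^ t + 1 : ℕ) : ℤ) ∣ s - 1 :=
    int_dvd_of_isIntegral (Nat.succ_ne_zero _) hz (by push_cast at hz2 ⊢; rw [hz2]; ring)
  rw [eq_neg_pow_of_dvd_sub_one (P := (p ^ t : ℤ)) (by exact_mod_cast hP)
    (by exact_mod_cast hdvd) hs2]

/-! ### Dimensions of the radicals from two moments -/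

open Classical in
/-- The dimensions of the radicals for `a ≠ 0` are `0` or `1`, with a linear relation between their
multiplicities. -/
lemma exists_radical_dimension (h : IsDivisibleQuadratic (p ^ t + 1) F) (hψ : ψ.IsPrimitive)
    (ht : 0 < t) {w : K} (hw : IsPrimitiveRoot w (p ^ t + 1)) {k : ℕ}
    (hK : Fintype.card K = (p ^ t) ^ (2 * k)) :
    ∃ m : K → ℕ, (∀ a, Nat.card (h.radical ψ a) = (p ^ (2 * t)) ^ m a) ∧
      (∑ a : {a : K // a ≠ 0}, (-(p ^ t : ℤ)) ^ m a = 0) ∧ ∀ a, a ≠ 0 → m a ≤ 1 := by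
  choose m hm hW using h.exists_charWalsh_zero_eq (ψ := ψ) ht hw hK
  have hP : 1 < p ^ t := Nat.one_lt_pow ht.ne' (Fact.out : p.Prime).one_lt
  set P : ℤ := (p ^ t : ℤ) with hPdef
  have hP' : 2 ≤ P := by rw [hPdef]; exact_mod_cast hP
  have hPk : (-P) ^ k ≠ 0 := pow_ne_zero _ (by omega)
  have hKZ : (Fintype.card K : ℤ) = P ^ (2 * k) := by rw [hK]; push_cast; rfl
  have hsplit : ∀ f : K → ℤ, ∑ a, f a = f 0 + ∑ a : {a : K // a ≠ 0}, f a := by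
    intro f
    rw [← Finset.add_sum_erase _ _ (Finset.mem_univ (0 : K))]
    congr 1
    exact Finset.sum_subtype _ (by simp) _
  have h0 : (-P) ^ (k + m 0) = P ^ (2 * k) := by
    have := hW 0
    simp only [charWalsh, zero_mul, add_zero, AddChar.map_zero_eq_one, Finset.sum_const,
      Finset.card_univ, nsmul_eq_mul, mul_one] at this
    rw [← hKZ]
    exact_mod_cast this.symm
  have hs1 : ∑ a : {a : K // a ≠ 0}, (-P) ^ m a = 0 := by
    have h1 := sum_charWalsh_zero hψ F
    rw [h.filter_eq_zero (Nat.succ_ne_zero _), Finset.card_singleton, Nat.cast_one, mul_one] at h1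
    simp only [hW] at h1
    have h2 : ∑ a, (-P) ^ (k + m a) = P ^ (2 * k) := by rw [← hKZ]; exact_mod_cast h1
    rw [hsplit, h0] at h2
    simp only [pow_add, ← Finset.mul_sum] at h2
    have h3 : (-P) ^ k * ∑ a : {a : K // a ≠ 0}, (-P) ^ m a = 0 := by linarith
    exact (mul_eq_zero.1 h3).resolve_left hPk
  have hcard : (Fintype.card {a : K // a ≠ 0} : ℤ) = P ^ (2 * k) - 1 := by
    rw [← hKZ, Fintype.card_subtype_compl, Fintype.card_subtype_eq,
      Nat.cast_sub Fintype.card_pos, Nat.cast_one]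
  have hs2 : ∑ a : {a : K // a ≠ 0}, ((-P) ^ m a) ^ 2 = P * (P ^ (2 * k) - 1) := by
    have h1 := sum_charWalsh_normSq_zero hψ F
    simp only [hW, map_intCast] at h1
    have h2 : ∑ a, (-P) ^ (k + m a) * (-P) ^ (k + m a) =
        P ^ (2 * k) * ∑ x, ((Finset.univ.filter fun y => F x = F y).card : ℤ) := by
      rw [← hKZ]; exact_mod_cast h1
    rw [hsplit, h0, hsplit] at h2
    have h3 : (Finset.univ.filter fun y => F 0 = F y).card = 1 := by
      rw [h.map_zero, Finset.filter_congr (fun y _ => eq_comm),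
        h.filter_eq_zero (Nat.succ_ne_zero _), Finset.card_singleton]
    have h4 : ∀ x : {a : K // a ≠ 0},
        ((Finset.univ.filter fun y => F x = F y).card : ℤ) = P + 1 := fun x => by
      rw [h.card_fiber (Nat.succ_pos _) hw x.2]; push_cast; rfl
    simp only [h3, h4, Finset.sum_const, Finset.card_univ, nsmul_eq_mul, hcard] at h2
    have h5 : ∑ a : {a : K // a ≠ 0}, (-P) ^ (k + m a) * (-P) ^ (k + m a) =
        P ^ (2 * k) * ∑ a : {a : K // a ≠ 0}, ((-P) ^ m a) ^ 2 := by
      rw [Finset.mul_sum]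
      refine Finset.sum_congr rfl fun a _ => ?_
      rw [show P ^ (2 * k) = ((-P) ^ k) ^ 2 by
        rw [← pow_mul (-P), mul_comm k, pow_mul, pow_mul, neg_sq]]
      ring
    rw [h5] at h2
    have h6 : P ^ (2 * k) ≠ 0 := pow_ne_zero _ (by omega)
    apply mul_left_cancel₀ h6
    push_cast at h2
    linear_combination h2
  -- The quadratic (X - 1)(X + P) has as roots the values of (-P)^j at j = 0 and j = 1. No other
  -- power of -P lies in the interval between them, so it is positive for j ≥ 2.
  have hnn : ∀ j : ℕ, 0 ≤ ((-P) ^ j - 1) * ((-P) ^ j + P) ∧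
      (((-P) ^ j - 1) * ((-P) ^ j + P) = 0 → j ≤ 1) := by
    intro j
    rcases j with _ | _ | j
    · simp
    · simp
    · have : 0 < ((-P) ^ (j + 2) - 1) * ((-P) ^ (j + 2) + P) := by
        have h1 : P ^ 2 ≤ P ^ (j + 2) := pow_le_pow_right₀ (by omega) (by omega)
        rcases Nat.even_or_odd (j + 2) with e | e
        · rw [e.neg_pow]; nlinarith
        · rw [e.neg_pow]
          have h2 : 0 < P ^ (j + 2) := pow_pos (by omega) _
          exact mul_pos_of_neg_of_neg (by omega) (by nlinarith)
      exact ⟨this.le, fun h => absurd h this.ne'⟩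
  have hs : ∑ a : {a : K // a ≠ 0}, ((-P) ^ m a - 1) * ((-P) ^ m a + P) = 0 := by
    have : ∀ a : {a : K // a ≠ 0}, ((-P) ^ m a - 1) * ((-P) ^ m a + P) =
        ((-P) ^ m a) ^ 2 + (P - 1) * (-P) ^ m a - P := fun a => by ring
    simp only [this, Finset.sum_sub_distrib, Finset.sum_add_distrib, ← Finset.mul_sum, hs1, hs2,
      Finset.sum_const, Finset.card_univ, nsmul_eq_mul, hcard]
    ring
  refine ⟨m, hm, hs1, fun a ha => (hnn (m a)).2 ?_⟩
  exact (Finset.sum_eq_zero_iff_of_nonneg fun a _ => (hnn _).1).1 hs ⟨a, ha⟩ (Finset.mem_univ _)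

end IsDivisibleQuadratic

/-! ### Reduction to the trace character and normalised fibres -/

lemma exists_traceChar (p : ℕ) [Fact p.Prime] {K : Type*} [Field K] [Fintype K]
    [Algebra (ZMod p) K] {ζ : ℂ} (hζ : IsPrimitiveRoot ζ p) :
    ∃ ψ : AddChar K ℂ, ψ.IsPrimitive ∧ ∀ F a b, walsh p ζ F a b = charWalsh ψ F a b := by
  let φ : AddChar (ZMod p) ℂ := AddChar.zmodChar p hζ.pow_eq_one
  have hφ : φ.IsPrimitive := AddChar.zmodChar_primitive_of_primitive_root p hζ
  refine ⟨φ.compAddMonoidHom (Algebra.trace (ZMod p) K).toAddMonoidHom, ?_, fun F a b => ?_⟩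
  · apply AddChar.IsPrimitive.of_ne_one
    obtain ⟨x, hx⟩ := Algebra.trace_surjective (ZMod p) K 1
    refine AddChar.ne_one_iff.2 ⟨x, fun h => ?_⟩
    have h1 : φ (Algebra.trace (ZMod p) K x) = 1 := h
    rw [hφ.zmod_char_eq_one_iff, hx] at h1
    exact one_ne_zero h1
  · rfl

lemma exists_primitiveRoot_of_dvd {K : Type*} [Field K] [Fintype K] {D : ℕ}
    (hD : D ∣ Fintype.card K - 1) : ∃ w : K, IsPrimitiveRoot w D := by
  classical
  obtain ⟨g, hg⟩ := IsCyclic.exists_generator (α := Kˣ)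
  have hord : orderOf g = Fintype.card K - 1 := by
    rw [orderOf_eq_card_of_forall_mem_zpowers hg, Nat.card_eq_fintype_card, Fintype.card_units]
  obtain ⟨c, hc⟩ := hD
  have h1 : IsPrimitiveRoot g (D * c) := by
    rw [← hc, ← hord]; exact IsPrimitiveRoot.orderOf g
  have hpos : 0 < D * c := by
    rw [← hc]
    have := Fintype.one_lt_card (α := K)
    omega
  exact ⟨(g ^ c : Kˣ), IsPrimitiveRoot.coe_units_iff.2 (h1.pow hpos (mul_comm _ _))⟩

/-- For nonzero x and y, the order of x/y divides q - 1, so it divides d exactly when it divides the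
gcd. -/
lemma pow_eq_pow_iff_pow_gcd {K : Type*} [Field K] [Fintype K] {d : ℕ} (hd : d ≠ 0) (x y : K) :
    x ^ d = y ^ d ↔ x ^ d.gcd (Fintype.card K - 1) = y ^ d.gcd (Fintype.card K - 1) := by
  have hg : d.gcd (Fintype.card K - 1) ≠ 0 := fun h => hd (Nat.gcd_eq_zero_iff.1 h).1
  rcases eq_or_ne y 0 with rfl | hy
  · rw [zero_pow hd, zero_pow hg, pow_eq_zero_iff hd, pow_eq_zero_iff hg]
  rcases eq_or_ne x 0 with rfl | hx
  · rw [zero_pow hd, zero_pow hg, eq_comm, pow_eq_zero_iff hd, @eq_comm _ 0, pow_eq_zero_iff hg]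
  have h : ∀ e : ℕ, x ^ e = y ^ e ↔ (x / y) ^ e = 1 := fun e => by
    rw [div_pow, div_eq_one_iff_eq (pow_ne_zero _ hy)]
  rw [h, h, ← orderOf_dvd_iff_pow_eq_one, ← orderOf_dvd_iff_pow_eq_one, Nat.dvd_gcd_iff]
  refine ⟨fun h1 => ⟨h1, ?_⟩, fun h1 => h1.1⟩
  exact orderOf_dvd_of_pow_eq_one (FiniteField.pow_card_sub_one_eq_one _ (div_ne_zero hx hy))

lemma HasAdditivePolar.sub_const {K : Type*} [Field K] {F : K → K} (h : HasAdditivePolar F)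
    (c : K) : HasAdditivePolar fun x => F x - c := by
  intro x y z
  have := h x y z
  simp only [polarForm] at this ⊢
  linear_combination this

lemma charWalsh_eq_mul_sub_const {K : Type*} [Field K] [Fintype K] (ψ : AddChar K ℂ)
    (F : K → K) (c a b : K) :
    charWalsh ψ F a b = ψ (a * c) * charWalsh ψ (fun x => F x - c) a b := by
  simp only [charWalsh, Finset.mul_sum, ← AddChar.map_add_eq_mul]
  exact Finset.sum_congr rfl fun x _ => by congr 1; ring

lemma norm_charWalsh_sub_const {K : Type*} [Field K] [Fintype K] (ψ : AddChar K ℂ)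
    (F : K → K) (c a b : K) :
    ‖charWalsh ψ (fun x => F x - c) a b‖ = ‖charWalsh ψ F a b‖ := by
  rw [charWalsh_eq_mul_sub_const ψ F c, norm_mul, AddChar.norm_apply, one_mul]

/-- The squared absolute values of the Walsh coefficients of a quadratic function whose fibres are the
cosets of the `(p ^ t + 1)`-th roots of unity. -/
lemma exists_radical_dimension_of_eq_iff {p t k : ℕ} [Fact p.Prime] {K : Type*} [Field K]
    [Fintype K] [CharP K p] {ψ : AddChar K ℂ} (hψ : ψ.IsPrimitive) {F : K → K}
    (hF : HasAdditivePolar F) (hinj : ∀ x y, F x = F y ↔ x ^ (p ^ t + 1) = y ^ (p ^ t + 1))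
    (ht : 0 < t) (hK : Fintype.card K = (p ^ t) ^ (2 * k))
    (hdvd : p ^ t + 1 ∣ Fintype.card K - 1) :
    ∃ m : K → ℕ, (∀ a, a ≠ 0 → m a ≤ 1) ∧ (∃ a, a ≠ 0 ∧ m a = 0) ∧ (∃ a, a ≠ 0 ∧ m a = 1) ∧
      ∀ a b, ‖charWalsh ψ F a b‖ ^ 2 = 0 ∨
        ‖charWalsh ψ F a b‖ ^ 2 = (p ^ t : ℝ) ^ (2 * (k + m a)) := by
  classical
  obtain ⟨w, hw⟩ := exists_primitiveRoot_of_dvd hdvd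
  -- Subtracting F(0) only multiplies Walsh coefficients by numbers of absolute value 1.
  have h : IsDivisibleQuadratic (p ^ t + 1) fun x => F x - F 0 :=
    ⟨sub_self _, hF.sub_const _, fun x y => by rw [sub_left_inj, hinj]⟩
  obtain ⟨m, hm, hs, hm1⟩ := h.exists_radical_dimension hψ ht hw hK
  have hP : 0 < (p ^ t : ℤ) := by exact_mod_cast pow_pos (Fact.out : p.Prime).pos t
  have hne : (Finset.univ : Finset {a : K // a ≠ 0}).Nonempty := ⟨⟨1, one_ne_zero⟩, by simp⟩
  refine ⟨m, hm1, ?_, ?_, fun a b => ?_⟩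
  -- If only one of the values 0, 1 occurred, all terms of the vanishing sum of (-P)^m(a) would have
  -- the same sign.
  · by_contra! hall
    have : ∑ a : {a : K // a ≠ 0}, (-(p ^ t : ℤ)) ^ m a < 0 := by
      refine Finset.sum_neg (fun a _ => ?_) hne
      have h1 : m a = 1 := by have := hm1 a a.2; have := hall a a.2; omega
      rw [h1, pow_one]; omega
    exact this.ne (by convert hs)
  · by_contra! hall
    have : 0 < ∑ a : {a : K // a ≠ 0}, (-(p ^ t : ℤ)) ^ m a := by
      refine Finset.sum_pos (fun a _ => ?_) hne
      have h1 : m a = 0 := by have := hm1 a a.2; have := hall a a.2; omega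
      rw [h1, pow_zero]; omega
    exact this.ne' (by convert hs)
  · have := h.charWalsh_norm_sq_cases (ψ := ψ) a b
    rw [norm_charWalsh_sub_const, hK, hm] at this
    refine this.imp_right fun e => e.trans ?_
    push_cast
    ring

/-! ### APN functions of cubes -/

/-- An APN function of the form `G (x ^ 3)` is injective on cubes if there is a primitive cube root of unity. -/
lemma IsAPN.eq_iff_pow_three {K : Type*} [Field K] [Fintype K] [CharP K 2] {F G : K → K}
    (hFG : ∀ x, F x = G (x ^ 3)) (hF : IsAPN F) {w : K} (hw : IsPrimitiveRoot w 3) (x y : K) :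
    F x = F y ↔ x ^ 3 = y ^ 3 := by
  refine ⟨fun hxy => ?_, fun h => by rw [hFG, hFG, h]⟩
  by_contra hne
  have hw3 : w ^ 3 = 1 := hw.pow_eq_one
  have hw0 : w ≠ 0 := hw.ne_zero (by norm_num)
  have hw1 : w ≠ 1 := hw.ne_one (by norm_num)
  have h2 : (2 : K) = 0 := CharTwo.two_eq_zero
  have hw2 : w ^ 2 + w + 1 = 0 := by
    have : (w - 1) * (w ^ 2 + w + 1) = 0 := by linear_combination hw3
    exact (mul_eq_zero.1 this).resolve_left (sub_ne_zero.2 hw1)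
  have hu : x + y ≠ 0 := by
    intro h
    apply hne
    rw [show x = y by linear_combination h - y * h2]
  have hinv : ∀ v z : K, v ^ 3 = z ^ 3 → F v = F z := fun v z h => by rw [hFG, hFG, h]
  have hcard : diffCount F (x + y) 0 ≤ 2 := hF.2 ⟨x + y, 0, hu, rfl⟩
  -- These are three solutions of F(z + x + y) = F(z): x is shifted to y, while w(x + y) and w²(x +
  -- y) are shifted to each other because 1 + w + w² = 0, and they have equal cubes.
  let S : Finset K := by classical exact {x, w * (x + y), w ^ 2 * (x + y)}
  have hS : S.card = 3 := by
    classical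
    rw [Finset.card_eq_three]
    refine ⟨x, w * (x + y), w ^ 2 * (x + y), ?_, ?_, ?_, by simp [S]⟩
    -- A coincidence x = w(x + y) forces y = w²(x + y), hence x³ = y³.
    · intro h
      apply hne
      have hy : y = w ^ 2 * (x + y) := by
        linear_combination -h - (x + y) * hw2 + (x + y) * h2
      have h3 := congrArg (· ^ 3) h
      have h4 := congrArg (· ^ 3) hy
      linear_combination h3 - h4 - (x + y) ^ 3 * w ^ 3 * hw3
    · intro h
      apply hne
      have hy : y = w * (x + y) := by
        linear_combination -h - (x + y) * hw2 + (x + y) * h2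
      have h3 := congrArg (· ^ 3) h
      have h4 := congrArg (· ^ 3) hy
      linear_combination h3 - h4 + (x + y) ^ 3 * w ^ 3 * hw3
    · intro h
      have h1 := mul_right_cancel₀ hu h
      rw [sq] at h1
      exact hw1 (mul_left_cancel₀ hw0 (by rw [← h1, mul_one]))
  have hsub : (S : Set K) ⊆ {z | F (z + (x + y)) - F z = 0} := by
    intro z hz
    simp only [S, Finset.coe_insert, Finset.coe_singleton, Set.mem_insert_iff,
      Set.mem_singleton_iff] at hz
    rw [Set.mem_ofPred_eq, sub_eq_zero]
    rcases hz with rfl | rfl | rfl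
    · rw [show z + (z + y) = y by linear_combination z * h2, hxy]
    · apply hinv
      rw [show w * (x + y) + (x + y) = w ^ 2 * (x + y) by
        linear_combination (x + y) * hw2 - w ^ 2 * (x + y) * h2]
      linear_combination (x + y) ^ 3 * w ^ 3 * hw3
    · apply hinv
      rw [show w ^ 2 * (x + y) + (x + y) = w * (x + y) by
        linear_combination (x + y) * hw2 - w * (x + y) * h2]
      linear_combination - (x + y) ^ 3 * w ^ 3 * hw3
  have h3 := Set.ncard_le_ncard hsub
  rw [Set.ncard_coe_finset, hS] at h3
  have h4 : 3 ≤ diffCount F (x + y) 0 := h3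
  omega

/-! ### Attaining all values -/

/-- If M is missed, r² = -M r throughout, so q² = -M ∑ r ≤ M q < q². -/
lemma exists_eq_of_moments {ι : Type*} [Fintype ι] {r : ι → ℝ} {M q : ℝ} (hq : 0 < q)
    (hMq : M < q) (hM : 0 ≤ M) (hr : ∀ i, r i = 0 ∨ r i = M ∨ r i = -M) (h1 : |∑ i, r i| ≤ q)
    (h2 : ∑ i, r i ^ 2 = q ^ 2) : ∃ i, r i = M := by
  by_contra! hne
  have h3 : ∀ i, r i ^ 2 = -M * r i := fun i => by
    rcases hr i with h | h | h
    · rw [h]; ring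
    · exact absurd h (hne i)
    · rw [h]; ring
  simp only [h3, ← Finset.mul_sum] at h2
  have := neg_le_of_abs_le h1
  nlinarith

/-- If 0 is missed, every square is M², so the second moment is too large. -/
lemma exists_eq_zero_of_moment {ι : Type*} [Fintype ι] {r : ι → ℝ} {M : ℝ}
    (hM : (Fintype.card ι : ℝ) < M ^ 2) (hι : 0 < Fintype.card ι)
    (hr : ∀ i, r i = 0 ∨ r i = M ∨ r i = -M)
    (h2 : ∑ i, r i ^ 2 = (Fintype.card ι : ℝ) ^ 2) : ∃ i, r i = 0 := by
  by_contra! hne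
  have h3 : ∀ i, r i ^ 2 = M ^ 2 := fun i => by
    rcases hr i with h | h | h
    · exact absurd h (hne i)
    · rw [h]
    · rw [h]; ring
  simp only [h3, Finset.sum_const, Finset.card_univ, nsmul_eq_mul] at h2
  have : (0 : ℝ) < Fintype.card ι := by exact_mod_cast hι
  nlinarith

lemma pow_add_one_dvd_pow_sub_one (P k : ℕ) : P + 1 ∣ P ^ (2 * k) - 1 := by
  rw [pow_mul]
  have h1 : P + 1 ∣ P ^ 2 - 1 := ⟨P - 1, by rw [← Nat.sq_sub_sq, one_pow]⟩
  have h2 := Nat.sub_dvd_pow_sub_pow (P ^ 2) 1 k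
  rw [one_pow] at h2
  exact h1.trans h2

lemma mem_walshSpectrum {p : ℕ} {ζ : ℂ} {K : Type*} [Field K] [Fintype K] [Algebra (ZMod p) K]
    {F : K → K} {z : ℂ} : z ∈ walshSpectrum p ζ F ↔ ∃ a b, a ≠ 0 ∧ walsh p ζ F a b = z := by
  simp [walshSpectrum]

/-- In characteristic two all Walsh coefficients are real. -/
lemma exists_real_charWalsh {K : Type*} [Field K] [Fintype K] [CharP K 2] (ψ : AddChar K ℂ)
    (F : K → K) : ∃ r : K → K → ℝ, ∀ a b, charWalsh ψ F a b = r a b := by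
  have : ∀ a b, ∃ r : ℝ, charWalsh ψ F a b = r := fun a b => by
    rw [← Complex.conj_eq_iff_real]
    simp only [charWalsh, map_sum, ← AddChar.map_neg_eq_conj, CharTwo.neg_eq]
  choose r hr using this
  exact ⟨r, hr⟩

/-! ### The two assertions of the theorem -/

lemma walsh_norm_sq_mem (p : ℕ) [Fact p.Prime] (n : ℕ) {K : Type*} [Field K] [Fintype K]
    [Algebra (ZMod p) K] (hK : Fintype.card K = p ^ n) {ζ : ℂ} (hζ : IsPrimitiveRoot ζ p)
    {d t k : ℕ} {F G : K → K} (ht : 0 < t) (hn : n = 2 * k * t)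
    (hd : Nat.gcd d (p ^ n - 1) = p ^ t + 1) (hFG : ∀ x, F x = G (x ^ d))
    (hF : IsQuadratic p F) (hG : Set.InjOn G (Set.range fun x : K => x ^ d)) {a : K} (b : K)
    (ha : a ≠ 0) :
    ‖walsh p ζ F a b‖ ^ 2 ∈ ({0, (p : ℝ) ^ n, (p : ℝ) ^ (n + 2 * t)} : Set ℝ) := by
  have := charP_of_injective_algebraMap (algebraMap (ZMod p) K).injective p
  obtain ⟨ψ, hψ, hW⟩ := exists_traceChar (K := K) p hζ
  have hd0 : d ≠ 0 := by
    rintro rfl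
    have : F = fun _ => G 1 := funext fun x => by rw [hFG, pow_zero]
    exact not_isQuadratic_const p (G 1) (this ▸ hF)
  have hinj : ∀ x y, F x = F y ↔ x ^ (p ^ t + 1) = y ^ (p ^ t + 1) := fun x y => by
    rw [← hd, ← hK, ← pow_eq_pow_iff_pow_gcd hd0, hFG, hFG]
    exact hG.eq_iff ⟨x, rfl⟩ ⟨y, rfl⟩
  have hK' : Fintype.card K = (p ^ t) ^ (2 * k) := by rw [hK, hn, ← pow_mul, mul_comm t]
  obtain ⟨m, hm, -, -, hcase⟩ := exists_radical_dimension_of_eq_iff hψ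
    (hasAdditivePolar_of_isQuadratic p hF) hinj ht hK' (by rw [hK, ← hd]; exact Nat.gcd_dvd_right _ _)
  rw [hW]
  rcases hcase a b with h | h
  · left; exact h
  · right
    have := hm a ha
    interval_cases hma : m a
    · left; rw [h, hn, ← pow_mul]; congr 1; ring
    · right; rw [Set.mem_singleton_iff, h, hn, ← pow_mul]; congr 1; ring

lemma walshSpectrum_of_isAPN (n : ℕ) {K : Type*} [Field K] [Fintype K]
    [Algebra (ZMod 2) K] (hK : Fintype.card K = 2 ^ n) {ζ : ℂ} (hζ : IsPrimitiveRoot ζ 2)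
    (hn : Even n) {F G : K → K} (hFG : ∀ x, F x = G (x ^ 3)) (hF : IsQuadratic 2 F)
    (hAPN : IsAPN F) :
    (∀ z ∈ walshSpectrum 2 ζ F,
      z ∈ ({0, 2 ^ (n / 2), -2 ^ (n / 2), 2 ^ (n / 2 + 1), -2 ^ (n / 2 + 1)} : Set ℂ)) ∧
    (4 ≤ n → {z : ℂ | z ∈ walshSpectrum 2 ζ F} =
      {0, 2 ^ (n / 2), -2 ^ (n / 2), 2 ^ (n / 2 + 1), -2 ^ (n / 2 + 1)}) := by
  have := charP_of_injective_algebraMap (algebraMap (ZMod 2) K).injective 2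
  obtain ⟨ψ, hψ, hW⟩ := exists_traceChar (K := K) 2 hζ
  obtain ⟨k, rfl⟩ := hn
  have hk : (k + k) / 2 = k := by omega
  rw [hk]
  have hK' : Fintype.card K = (2 ^ 1) ^ (2 * k) := by rw [hK, pow_one, two_mul]
  have hdvd : 2 ^ 1 + 1 ∣ Fintype.card K - 1 := by
    rw [hK']; exact pow_add_one_dvd_pow_sub_one _ _
  obtain ⟨w, hw⟩ := exists_primitiveRoot_of_dvd hdvd
  obtain ⟨m, hm, ⟨a₀, ha₀, hm₀⟩, ⟨a₁, ha₁, hm₁⟩, hcase⟩ := exists_radical_dimension_of_eq_iff hψ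
    (hasAdditivePolar_of_isQuadratic 2 hF) (hAPN.eq_iff_pow_three hFG hw) one_pos hK' hdvd
  obtain ⟨r, hr⟩ := exists_real_charWalsh ψ F
  have hr3 : ∀ a b, r a b = 0 ∨ r a b = 2 ^ (k + m a) ∨ r a b = -2 ^ (k + m a) := by
    intro a b
    have h1 := hcase a b
    rw [hr, Complex.norm_real, Real.norm_eq_abs, sq_abs] at h1
    rcases h1 with h1 | h1
    · left; exact pow_eq_zero_iff two_ne_zero |>.1 h1
    · right
      apply sq_eq_sq_iff_eq_or_eq_neg.1
      rw [h1]; push_cast; ring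
  have hmem : ∀ z ∈ walshSpectrum 2 ζ F,
      z ∈ ({0, 2 ^ k, -2 ^ k, 2 ^ (k + 1), -2 ^ (k + 1)} : Set ℂ) := by
    intro z hz
    obtain ⟨a, b, ha, rfl⟩ := mem_walshSpectrum.1 hz
    have h1 := hm a ha
    have h2 := hr3 a b
    rw [hW, hr]
    simp only [Set.mem_insert_iff, Set.mem_singleton_iff]
    interval_cases m a
    all_goals
      rcases h2 with h2 | h2 | h2
      all_goals rw [h2]; simp
  refine ⟨hmem, fun hn4 => Set.Subset.antisymm hmem ?_⟩
  have hq : (Fintype.card K : ℝ) = 2 ^ (2 * k) := by rw [hK']; norm_num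
  have hq0 : (0 : ℝ) < Fintype.card K := by exact_mod_cast Fintype.card_pos
  have hsq : ∀ a, ∑ b, r a b ^ 2 = (Fintype.card K : ℝ) ^ 2 := by
    intro a
    have h1 := sum_charWalsh_normSq_right hψ F a
    simp only [hr, Complex.conj_ofReal, ← sq] at h1
    exact_mod_cast h1
  have hsum : ∀ a, |∑ b, r a b| = Fintype.card K := by
    intro a
    have h1 := congrArg norm (sum_charWalsh_right hψ F a)
    simp only [hr, norm_mul, AddChar.norm_apply, mul_one, Complex.norm_natCast] at h1
    rw [← h1, ← Complex.ofReal_sum, Complex.norm_real, Real.norm_eq_abs]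
  have hM : ∀ a, a ≠ 0 → (2 : ℝ) ^ (k + m a) < Fintype.card K := fun a ha => by
    rw [hq]
    have := hm a ha
    -- Here n ≥ 4 enters: k ≥ 2 and m(a) ≤ 1 give k + m(a) < 2k.
    exact pow_lt_pow_right₀ one_lt_two (by omega)
  have hpos : ∀ a, a ≠ 0 → ∃ b, r a b = 2 ^ (k + m a) := fun a ha =>
    exists_eq_of_moments hq0 (hM a ha) (by positivity) (hr3 a) (hsum a).le (hsq a)
  have hneg : ∀ a, a ≠ 0 → ∃ b, r a b = -2 ^ (k + m a) := fun a ha => by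
    obtain ⟨b, hb⟩ := exists_eq_of_moments (r := fun b => - r a b) hq0 (hM a ha) (by positivity)
      (fun b => by
        rcases hr3 a b with h | h | h
        · left; rw [h, neg_zero]
        · right; right; rw [h]
        · right; left; rw [h, neg_neg])
      (by rw [Finset.sum_neg_distrib, abs_neg]; exact (hsum a).le)
      (by simpa only [neg_sq] using hsq a)
    exact ⟨b, by rw [← hb, neg_neg]⟩
  -- The value 0 is sought at m = 1, where M² = 4q exceeds q; at m = 0 one has M² = q and this
  -- argument fails.
  have hzero : ∃ b, r a₁ b = 0 := by
    refine exists_eq_zero_of_moment ?_ Fintype.card_pos (hr3 a₁) (hsq a₁)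
    rw [hq, hm₁, ← pow_mul]
    exact pow_lt_pow_right₀ one_lt_two (by omega)
  intro z hz
  rw [Set.mem_ofPred_eq, mem_walshSpectrum]
  simp only [Set.mem_insert_iff, Set.mem_singleton_iff] at hz
  rcases hz with rfl | rfl | rfl | rfl | rfl
  · obtain ⟨b, hb⟩ := hzero
    exact ⟨a₁, b, ha₁, by rw [hW, hr, hb]; simp⟩
  · obtain ⟨b, hb⟩ := hpos a₀ ha₀
    exact ⟨a₀, b, ha₀, by rw [hW, hr, hb, hm₀]; simp⟩
  · obtain ⟨b, hb⟩ := hneg a₀ ha₀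
    exact ⟨a₀, b, ha₀, by rw [hW, hr, hb, hm₀]; simp⟩
  · obtain ⟨b, hb⟩ := hpos a₁ ha₁
    exact ⟨a₁, b, ha₁, by rw [hW, hr, hb, hm₁]; simp⟩
  · obtain ⟨b, hb⟩ := hneg a₁ ha₁
    exact ⟨a₁, b, ha₁, by rw [hW, hr, hb, hm₁]; simp⟩

theorem theorem4 (p : ℕ) [Fact p.Prime] (n : ℕ) (K : Type*) [Field K] [Fintype K]
    [Algebra (ZMod p) K] (hK : Fintype.card K = p ^ n) (ζ : ℂ) (hζ : IsPrimitiveRoot ζ p) :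
    (∀ (d t k : ℕ) (F G : K → K), 0 < t → n = 2 * k * t →
      Nat.gcd d (p ^ n - 1) = p ^ t + 1 →
      (∀ x, F x = G (x ^ d)) →
      IsQuadratic p F →
      Set.InjOn G (Set.range fun x : K => x ^ d) →
      ∀ a b : K, a ≠ 0 →
        ‖walsh p ζ F a b‖ ^ 2 ∈ ({0, (p : ℝ) ^ n, (p : ℝ) ^ (n + 2 * t)} : Set ℝ)) ∧
    (p = 2 → Even n → ∀ F G : K → K,
      (∀ x, F x = G (x ^ 3)) →
      IsQuadratic p F →
      IsAPN F →
      (∀ z ∈ walshSpectrum p ζ F,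
        z ∈ ({0, 2 ^ (n / 2), -2 ^ (n / 2), 2 ^ (n / 2 + 1), -2 ^ (n / 2 + 1)} : Set ℂ)) ∧
      (4 ≤ n → {z : ℂ | z ∈ walshSpectrum p ζ F} =
        {0, 2 ^ (n / 2), -2 ^ (n / 2), 2 ^ (n / 2 + 1), -2 ^ (n / 2 + 1)})) := by
  refine ⟨fun d t k F G ht hn hd hFG hF hG a b ha =>
    walsh_norm_sq_mem p n hK hζ ht hn hd hFG hF hG b ha, ?_⟩
  rintro rfl hn F G hFG hF hAPN
  exact walshSpectrum_of_isAPN n hK hζ hn hFG hF hAPN
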